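/- Let $n,r,s\ge 0$ be integers, $x=(x_1,\dots,x_n)$, and let $M$ be a finitely generated $\mathbb{Z}[[x]]$-module with a presentation $$\mathbb{Z}[[x]]^r \xrightarrow{\;T\;} \mathbb{Z}[[x]]^s \to M \to 0 .$$ For a field $K$ set $M\hat\otimes_{\mathbb{Z}}K:=\varprojlim_m\big((M/\langle x\rangle^m M)\otimes_{\mathbb{Z}}K\big)$. Put $M_p := M\hat\otimes_{\mathbb{Z}}\mathbb{F}_p$ for a prime number $p$, and $M_0 := M\hat\otimes_{\mathbb{Z}}\mathbb{Q}$. Then, as vector spaces over $\mathbb{F}_p$ and $\mathbb{Q}$ respectively, $$M_p \cong \operatorname{coker}\big(\mathbb{F}_p[[x]]^r \xrightarrow{\;\bar T\;} \mathbb{F}_p[[x]]^s\big),\qquad M_0 \cong \operatorname{coker}\big(\mathbb{Q}[[x]]^r \xrightarrow{\;\bar T\;} \mathbb{Q}[[x]]^s\big),$$ where $\bar T$ is obtained from $T$ by mapping all coefficients of its entries to $\mathbb{F}_p$, respectively to $\mathbb{Q}$. Moreover: 1. Let $p$ be a prime number with $\dim_{\mathbb{F}_p} M_p<\infty$. Then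 $\dim_{\mathbb{Q}} M_0\le \dim_{\mathbb{F}_p} M_p$, and $\dim_{\mathbb{F}_q} M_q\le \dim_{\mathbb{F}_p} M_p$ for all but finitely many prime numbers $q$. 2. If $\dim_{\mathbb{Q}} M_0<\infty$, then $\dim_{\mathbb{F}_q} M_q=\dim_{\mathbb{Q}} M_0$ for all but finitely many prime numbers $q$. -/

import Mathlib

open scoped TensorProduct

noncomputable section

namespace FormalFamily

/-- The ideal `⟨x⟩ = ⟨x₁, …, xₙ⟩` of `ℤ[[x₁, …, xₙ]]`. -/
def xIdeal (n : ℕ) : Ideal (MvPowerSeries (Fin n) ℤ) :=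
  Ideal.span (Set.range fun i : Fin n => (MvPowerSeries.X i : MvPowerSeries (Fin n) ℤ))

/-- The quotient `M / ⟨x⟩ᵐ M`. -/
abbrev XQuot (n : ℕ) (M : Type*) [AddCommGroup M] [Module (MvPowerSeries (Fin n) ℤ) M]
    (m : ℕ) : Type _ :=
  M ⧸ (xIdeal n ^ m • ⊤ : Submodule (MvPowerSeries (Fin n) ℤ) M)

/-- The canonical projection `M / ⟨x⟩ˡ M → M / ⟨x⟩ᵐ M` for `m ≤ l`, as a map of
abelian groups. -/
def xProj (n : ℕ) (M : Type*) [AddCommGroup M] [Module (MvPowerSeries (Fin n) ℤ) M]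
    {m l : ℕ} (h : m ≤ l) : XQuot n M l →ₗ[ℤ] XQuot n M m :=
  (Submodule.factor (Submodule.smul_mono_left (Ideal.pow_le_pow_right h))).restrictScalars ℤ

/-- The completed tensor product of `M` with `K` over `ℤ`: the inverse limit over `m` of
`K ⊗_ℤ (M / ⟨x⟩ᵐ M)`, realized as the `K`-module of compatible sequences in the product.
For `K = 𝔽_p` and `K = ℚ` (the residue fields of `ℤ` at `⟨p⟩` and `⟨0⟩`) it is the
completed fibre of `M` over `⟨p⟩` and `⟨0⟩`. -/
def completedFibre (n : ℕ) (K : Type*) [CommRing K] (M : Type*) [AddCommGroup M]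
    [Module (MvPowerSeries (Fin n) ℤ) M] :
    Submodule K (∀ m : ℕ, K ⊗[ℤ] XQuot n M m) where
  carrier := {f | ∀ (m l : ℕ) (h : m ≤ l), (xProj n M h).baseChange K (f l) = f m}
  zero_mem' := fun m l h => by simp
  add_mem' := fun {f g} hf hg m l h => by simp [hf m l h, hg m l h]
  smul_mem' := fun c f hf m l h => by simp [hf m l h]

/-- The matrix over `K[[x]]` induced by a matrix over `ℤ[[x]]`: the coefficients of all
entries are mapped to `K`. -/
def inducedMatrix {n r s : ℕ} (K : Type*) [CommRing K]
    (T : Matrix (Fin s) (Fin r) (MvPowerSeries (Fin n) ℤ)) :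
    Matrix (Fin s) (Fin r) (MvPowerSeries (Fin n) K) :=
  T.map (MvPowerSeries.map (Int.castRingHom K))

/-- The cokernel of the induced map `K[[x]]ʳ → K[[x]]ˢ`. -/
abbrev inducedCoker {n r s : ℕ} (K : Type*) [CommRing K]
    (T : Matrix (Fin s) (Fin r) (MvPowerSeries (Fin n) ℤ)) : Type _ :=
  (Fin s → MvPowerSeries (Fin n) K) ⧸ LinearMap.range (inducedMatrix K T).mulVecLin

end FormalFamily

end

/-! Modulo `⟨x⟩ᵐ` only finitely many monomials matter, so `K ⊗ M/⟨x⟩ᵐM` is `K[[x]]ˢ` modulo `im T̄ +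
⟨x⟩ᵐ` (`stageMap_eq_zero_iff`). The cokernel of `T̄` is finite over the noetherian complete ring
`K[[x]]`, hence `⟨x⟩`-adically complete, so it is the limit of these stages.

For the dimensions, each `M/⟨x⟩ᵐM` is a finitely generated abelian group: its fibre dimension is at
least its rank, with equality away from finitely many primes (`exists_rank_baseChange`). If `M_p` is
finite-dimensional, it bounds all rational stages; their surjective transition maps are then
eventually injective, and `M_0` equals one stage, of dimension at most `dim M_p`.

If `M_0` is finite-dimensional, the rational transitions are injective from some `N` on, so a
nonzero integer `e` kills `⟨x⟩ᴺM/⟨x⟩ᴺ⁺¹M`. Multiplying by powers of `⟨x⟩`, the same `e` works for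
all `m ≥ N` (`smul_mem_pow_of_smul_mem`). Hence for primes `q ∤ e` also `M_q` equals stage `N`, and
dimensions are compared on that single group. The bound on `M_q` in part 1 then follows from part 2.
-/

noncomputable section
namespace FormalFamily

/-- The ideal generated by the variables of `R[[x₁, …, xₙ]]`. -/
abbrev varIdeal (n : ℕ) (R : Type*) [CommRing R] : Ideal (MvPowerSeries (Fin n) R) :=
  Ideal.span (Set.range MvPowerSeries.X)

/-- The finite set of exponents of total degree less than `m`. -/
def lowExponents (n m : ℕ) : Finset (Fin n →₀ ℕ) :=
  (Finsupp.finite_of_degree_lt m).toFinset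

theorem mem_lowExponents {n m : ℕ} {d : Fin n →₀ ℕ} : d ∈ lowExponents n m ↔ d.degree < m := by
  simp [lowExponents]

/-! ### Truncation and the `⟨x⟩`-adic filtration of power series -/

section PowerSeries

variable {n : ℕ} {R : Type*} [CommRing R]

theorem coeff_eq_zero_of_mem_varIdeal_pow {m : ℕ} {f : MvPowerSeries (Fin n) R}
    (hf : f ∈ varIdeal n R ^ m) {d : Fin n →₀ ℕ} (hd : d.degree < m) :
    MvPowerSeries.coeff d f = 0 := by
  classical
  have hX : ∀ g ∈ varIdeal n R, MvPowerSeries.coeff 0 g = 0 := by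
    intro g hg
    have : varIdeal n R ≤ RingHom.ker (MvPowerSeries.constantCoeff (σ := Fin n) (R := R)) := by
      rw [Ideal.span_le]
      rintro _ ⟨i, rfl⟩
      simp
    simpa using this hg
  induction m generalizing f d with
  | zero => simp at hd
  | succ m ih =>
    rw [pow_succ'] at hf
    refine Submodule.mul_induction_on hf (fun g hg h hh => ?_) (fun g h hg hh => ?_)
    · rw [MvPowerSeries.coeff_mul]
      refine Finset.sum_eq_zero fun p hp => ?_
      rw [Finset.HasAntidiagonal.mem_antidiagonal] at hp
      by_cases h0 : p.1 = 0
      · rw [h0, hX g hg, zero_mul]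
      · have h1 : p.1.degree ≠ 0 := by simpa [Finsupp.degree_eq_zero_iff] using h0
        have h2 : p.1.degree + p.2.degree = d.degree := by rw [← hp, map_add]
        rw [ih hh (by omega), mul_zero]
    · rw [map_add, hg, hh, add_zero]

/-- The truncations of `f` form a Cauchy sequence, so completeness gives a limit `L` congruent to
each of them modulo the matching power. Comparing coefficients shows `L = f`. -/
theorem sub_truncTotal_mem (f : MvPowerSeries (Fin n) R) (m : ℕ) :
    f - (MvPowerSeries.truncTotal m f : MvPolynomial (Fin n) R) ∈ varIdeal n R ^ m := by
  have hmap : ∀ (k : ℕ) (p : MvPolynomial (Fin n) R), p ∈ MvPolynomial.idealOfVars (Fin n) R ^ k →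
      (p : MvPowerSeries (Fin n) R) ∈ varIdeal n R ^ k := by
    intro k p hp
    have h := Ideal.mem_map_of_mem
      (MvPolynomial.coeToMvPowerSeries.ringHom (σ := Fin n) (R := R)) hp
    rw [Ideal.map_pow, Ideal.map_span, ← Set.range_comp] at h
    have hX : ⇑(MvPolynomial.coeToMvPowerSeries.ringHom (σ := Fin n) (R := R)) ∘
        MvPolynomial.X = MvPowerSeries.X := by
      ext1 i
      simp
    rwa [hX] at h
  obtain ⟨L, hL⟩ := (inferInstance : IsAdicComplete (varIdeal n R) _).toIsPrecomplete.prec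
    (f := fun k => ((MvPowerSeries.truncTotal k f : MvPolynomial (Fin n) R) :
      MvPowerSeries (Fin n) R)) (by
      intro k l hkl
      rw [SModEq.sub_mem]
      rw [smul_eq_mul, Ideal.mul_top]
      have h := hmap k _
        (MvPowerSeries.truncTotal_sub_truncTotal_mem_pow_idealOfVars le_rfl hkl f)
      rwa [← MvPolynomial.coeToMvPowerSeries.ringHom_apply, map_sub] at h)
  have hLf : L = f := by
    ext d
    have h := hL (d.degree + 1)
    rw [SModEq.sub_mem, smul_eq_mul, Ideal.mul_top] at h
    have := coeff_eq_zero_of_mem_varIdeal_pow h (Nat.lt_succ_self d.degree)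
    rw [map_sub, sub_eq_zero, MvPolynomial.coeff_coe,
      MvPowerSeries.coeff_truncTotal _ (Nat.lt_succ_self _)] at this
    exact this.symm
  have h := hL m
  rw [SModEq.comm, SModEq.sub_mem, smul_eq_mul, Ideal.mul_top, hLf] at h
  exact h

theorem mem_varIdeal_pow_iff {m : ℕ} {f : MvPowerSeries (Fin n) R} :
    f ∈ varIdeal n R ^ m ↔
      ∀ d : Fin n →₀ ℕ, d.degree < m → MvPowerSeries.coeff d f = 0 := by
  refine ⟨fun hf d hd => coeff_eq_zero_of_mem_varIdeal_pow hf hd, fun h => ?_⟩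
  have h0 : MvPowerSeries.truncTotal m f = 0 := by
    ext d
    rw [MvPowerSeries.coeff_truncTotal_eq_ite]
    simp +contextual [h d]
  simpa [h0] using sub_truncTotal_mem f m

theorem mem_ideal_smul_top_pi {A ι : Type*} [CommRing A] [Fintype ι] {I : Ideal A} {v : ι → A} :
    v ∈ (I • ⊤ : Submodule A (ι → A)) ↔ ∀ i, v i ∈ I := by
  classical
  constructor
  · intro hv i
    refine Submodule.smul_induction_on hv (fun a ha w _ => ?_) (fun v w hv hw => ?_)
    · exact I.mul_mem_right _ ha
    · exact I.add_mem hv hw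
  · intro hv
    rw [pi_eq_sum_univ' v]
    exact Submodule.sum_mem _ fun i _ => Submodule.smul_mem_smul (hv i) trivial

theorem mem_varIdeal_pow_smul_top_iff {ι : Type*} [Fintype ι] {m : ℕ}
    {v : ι → MvPowerSeries (Fin n) R} :
    v ∈ (varIdeal n R ^ m • ⊤ : Submodule (MvPowerSeries (Fin n) R) _) ↔
      ∀ i (d : Fin n →₀ ℕ), d.degree < m → MvPowerSeries.coeff d (v i) = 0 := by
  simp only [mem_ideal_smul_top_pi, mem_varIdeal_pow_iff]

/-- The vector with the single monomial `x ^ d` in position `i`. -/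
def monomialVec (R : Type*) [CommRing R] {ι : Type*} [DecidableEq ι] (i : ι) (d : Fin n →₀ ℕ) :
    ι → MvPowerSeries (Fin n) R :=
  Pi.single i (MvPowerSeries.monomial d 1)

theorem sub_sum_monomialVec_mem {ι : Type*} [Fintype ι] [DecidableEq ι]
    (v : ι → MvPowerSeries (Fin n) R) (m : ℕ) :
    v - ∑ i, ∑ d ∈ lowExponents n m, MvPowerSeries.coeff d (v i) • monomialVec R i d ∈
      (varIdeal n R ^ m • ⊤ : Submodule (MvPowerSeries (Fin n) R) _) := by
  classical
  rw [mem_varIdeal_pow_smul_top_iff]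
  intro j e he
  have : e ∈ lowExponents n m := mem_lowExponents.2 he
  simp [monomialVec, Finset.sum_apply, Pi.single_apply, apply_ite, MvPowerSeries.coeff_monomial,
    this]

end PowerSeries

/-! ### Change of coefficients from `ℤ` to `K` -/

section MapVec

variable {n : ℕ} {K : Type*} [CommRing K]

/-- Coefficientwise image in `K[[x]]` of a vector over `ℤ[[x]]`. -/
def mapVec (K : Type*) [CommRing K] (ι : Type*) :
    (ι → MvPowerSeries (Fin n) ℤ) →ₗ[ℤ] (ι → MvPowerSeries (Fin n) K) :=
  ((MvPowerSeries.map (σ := Fin n) (Int.castRingHom K)).toAddMonoidHom.compLeft ι).toIntLinearMap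

@[simp]
theorem mapVec_apply {ι : Type*} (u : ι → MvPowerSeries (Fin n) ℤ) (i : ι) :
    mapVec K ι u i = MvPowerSeries.map (Int.castRingHom K) (u i) := rfl

theorem mapVec_monomialVec {ι : Type*} [DecidableEq ι] (i : ι) (d : Fin n →₀ ℕ) :
    mapVec K ι (monomialVec ℤ i d) = monomialVec K i d := by
  ext1 j
  by_cases h : j = i
  · subst h; simp [monomialVec]
  · simp [monomialVec, h]

theorem mapVec_mem {ι : Type*} [Fintype ι] {m : ℕ} {u : ι → MvPowerSeries (Fin n) ℤ}
    (hu : u ∈ (varIdeal n ℤ ^ m • ⊤ : Submodule (MvPowerSeries (Fin n) ℤ) _)) :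
    mapVec K ι u ∈ (varIdeal n K ^ m • ⊤ : Submodule (MvPowerSeries (Fin n) K) _) := by
  rw [mem_varIdeal_pow_smul_top_iff] at hu ⊢
  intro i d hd
  simp [hu i d hd]

/-- Integral vectors need not span `K[[x]]ˢ` over `K`. They do modulo `⟨x⟩ᵐ`, through the monomial
vectors, which is why both maps must kill that submodule. -/
theorem linearMap_ext_of_truncation {ι V : Type*} [Fintype ι] [AddCommGroup V] [Module K V]
    (m : ℕ) {f g : (ι → MvPowerSeries (Fin n) K) →ₗ[K] V}
    (hf : ∀ v ∈ (varIdeal n K ^ m • ⊤ : Submodule (MvPowerSeries (Fin n) K) _), f v = 0)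
    (hg : ∀ v ∈ (varIdeal n K ^ m • ⊤ : Submodule (MvPowerSeries (Fin n) K) _), g v = 0)
    (h : ∀ u, f (mapVec K ι u) = g (mapVec K ι u)) : f = g := by
  classical
  refine LinearMap.ext fun v => ?_
  have hv := sub_sum_monomialVec_mem v m
  have h1 := hf _ hv
  have h2 := hg _ hv
  rw [map_sub, sub_eq_zero] at h1 h2
  rw [h1, h2]
  have key : ∀ i d, f (monomialVec K i d) = g (monomialVec K i d) := fun i d => by
    rw [← mapVec_monomialVec, h]
  simp only [map_sum, map_smul, key]

theorem inducedMatrix_mulVec_mapVec {r s : ℕ}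
    (T : Matrix (Fin s) (Fin r) (MvPowerSeries (Fin n) ℤ)) (w : Fin r → MvPowerSeries (Fin n) ℤ) :
    (inducedMatrix K T).mulVecLin (mapVec K _ w) = mapVec K _ (T.mulVecLin w) := by
  ext1 i
  simp [inducedMatrix, Matrix.mulVec, dotProduct, map_sum]

end MapVec

end FormalFamily
end

/-! ### Adic completeness of finite modules -/

noncomputable section
namespace FormalFamily

/-- For finite `N` the completion of `N` is a quotient of `Â ⊗ N`, and every element of `Â` comes
from `A`. -/
theorem isPrecomplete_of_finite {A : Type*} [CommRing A] (I : Ideal A) [IsPrecomplete I A]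
    (N : Type*) [AddCommGroup N] [Module A N] [Module.Finite A N] : IsPrecomplete I N := by
  rw [← AdicCompletion.of_surjective_iff]
  intro y
  obtain ⟨t, rfl⟩ := AdicCompletion.ofTensorProduct_surjective_of_finite I N y
  induction t with
  | zero => exact ⟨0, by simp⟩
  | tmul a x =>
    obtain ⟨a, rfl⟩ := AdicCompletion.of_surjective I A a
    refine ⟨a • x, ?_⟩
    rw [AdicCompletion.ofTensorProduct_tmul]
    ext k
    rw [AdicCompletion.smul_eval, AdicCompletion.of_apply, AdicCompletion.of_apply]
    rfl
  | add t u ht hu =>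
    obtain ⟨a, ha⟩ := ht
    obtain ⟨b, hb⟩ := hu
    exact ⟨a + b, by rw [map_add, map_add, ha, hb]⟩

theorem isAdicComplete_of_finite {A : Type*} [CommRing A] [IsNoetherianRing A] (I : Ideal A)
    [IsAdicComplete I A] (N : Type*) [AddCommGroup N] [Module A N] [Module.Finite A N] :
    IsAdicComplete I N where
  toIsHausdorff := IsHausdorff.of_le_jacobson I N (IsAdicComplete.le_jacobson_bot I)
  toIsPrecomplete := isPrecomplete_of_finite I N

theorem map_eq_map_iff_map_sub_eq_zero {K V X : Type*} [Ring K] [AddCommGroup V] [AddCommMonoid X]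
    [Module K V] [Module K X] (g : V →ₗ[K] X) (a b : V) : g a = g b ↔ g (a - b) = 0 := by
  constructor
  · intro hab
    rw [sub_eq_add_neg, map_add, hab, ← map_add, add_neg_cancel, map_zero]
  · intro hab
    rw [← sub_add_cancel a b, map_add, hab, zero_add]

theorem nonempty_linearEquiv_of_surjective {K V W U : Type*} [Ring K] [AddCommGroup V]
    [AddCommMonoid W] [AddCommMonoid U] [Module K V] [Module K W] [Module K U]
    {f : V →ₗ[K] W} {q : V →ₗ[K] U} (hf : Function.Surjective f) (hq : Function.Surjective q)
    (h : ∀ v, f v = 0 ↔ q v = 0) : Nonempty (W ≃ₗ[K] U) := by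
  have key : ∀ a b, f a = f b ↔ q a = q b := fun a b => by
    rw [map_eq_map_iff_map_sub_eq_zero f, map_eq_map_iff_map_sub_eq_zero q, h]
  have hinv : ∀ v, q (Function.surjInv hf (f v)) = q v := fun v =>
    (key _ _).1 (Function.surjInv_eq hf (f v))
  let e : W →ₗ[K] U :=
    { toFun := fun w => q (Function.surjInv hf w)
      map_add' := fun a b => by
        obtain ⟨a, rfl⟩ := hf a
        obtain ⟨b, rfl⟩ := hf b
        rw [← map_add, hinv, hinv, hinv, map_add]
      map_smul' := fun c a => by
        obtain ⟨a, rfl⟩ := hf a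
        rw [← map_smul, hinv, hinv, map_smul, RingHom.id_apply] }
  refine ⟨LinearEquiv.ofBijective e ⟨fun a b hab => ?_, fun u => ?_⟩⟩
  · obtain ⟨a, rfl⟩ := hf a
    obtain ⟨b, rfl⟩ := hf b
    have hab : q (Function.surjInv hf (f a)) = q (Function.surjInv hf (f b)) := hab
    rwa [hinv, hinv, ← key] at hab
  · obtain ⟨v, rfl⟩ := hq u
    exact ⟨f v, hinv v⟩

/-! ### The stages `K ⊗ M/⟨x⟩ᵐM` as quotients of `K[[x]]ˢ` -/

section Stage

variable {n s : ℕ} {M : Type*} [AddCommGroup M] [Module (MvPowerSeries (Fin n) ℤ) M]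
  (π : (Fin s → MvPowerSeries (Fin n) ℤ) →ₗ[MvPowerSeries (Fin n) ℤ] M)

/-- The composite `ℤ[[x]]ˢ → M → M / ⟨x⟩ᵐ M`. -/
def stageProj (m : ℕ) : (Fin s → MvPowerSeries (Fin n) ℤ) →ₗ[ℤ] XQuot n M m :=
  ((Submodule.mkQ _).comp π).restrictScalars ℤ

theorem stageProj_apply (m : ℕ) (u : Fin s → MvPowerSeries (Fin n) ℤ) :
    stageProj π m u = Submodule.Quotient.mk (π u) := rfl

variable {π} in
theorem stageProj_surjective (hsurj : Function.Surjective π) (m : ℕ) :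
    Function.Surjective (stageProj π m) :=
  (Submodule.mkQ_surjective _).comp hsurj

theorem stageProj_eq_zero_of_mem {m : ℕ} {u : Fin s → MvPowerSeries (Fin n) ℤ}
    (hu : u ∈ (varIdeal n ℤ ^ m • ⊤ : Submodule (MvPowerSeries (Fin n) ℤ) _)) :
    stageProj π m u = 0 := by
  rw [stageProj_apply, Submodule.Quotient.mk_eq_zero]
  have h := Submodule.mem_map_of_mem (f := π) hu
  rw [Submodule.map_smul''] at h
  exact Submodule.smul_mono le_rfl le_top h

theorem stageProj_eq_sum (m : ℕ) (u : Fin s → MvPowerSeries (Fin n) ℤ) :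
    stageProj π m u = ∑ i, ∑ d ∈ lowExponents n m,
      MvPowerSeries.coeff d (u i) • stageProj π m (monomialVec ℤ i d) := by
  have h := stageProj_eq_zero_of_mem π (sub_sum_monomialVec_mem u m)
  rw [map_sub, sub_eq_zero] at h
  rw [h]
  rw [map_sum]
  refine Finset.sum_congr rfl fun i _ => ?_
  rw [map_sum]
  exact Finset.sum_congr rfl fun d _ => by
    have h := map_intCast_smul (stageProj π m) ℤ ℤ
      (MvPowerSeries.coeff d (u i)) (monomialVec ℤ i d)
    simp only [Int.cast_id] at h
    exact h

theorem xProj_stageProj {m l : ℕ} (h : m ≤ l) (u : Fin s → MvPowerSeries (Fin n) ℤ) :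
    xProj n M h (stageProj π l u) = stageProj π m u := rfl

variable {π} in
theorem finite_xQuot (hsurj : Function.Surjective π) (m : ℕ) : Module.Finite ℤ (XQuot n M m) := by
  classical
  refine ⟨⟨(Finset.univ ×ˢ lowExponents n m).image
    fun p : Fin s × (Fin n →₀ ℕ) => stageProj π m (monomialVec ℤ p.1 p.2), ?_⟩⟩
  rw [eq_top_iff]
  rintro a -
  obtain ⟨u, rfl⟩ := stageProj_surjective hsurj m a
  rw [stageProj_eq_sum]
  refine Submodule.sum_mem _ fun i _ => Submodule.sum_mem _ fun d hd => Submodule.smul_mem _ _ ?_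
  refine Submodule.subset_span ?_
  simp only [Finset.coe_image, Set.mem_image]
  exact ⟨(i, d), by simpa using hd, rfl⟩

variable (K : Type*) [CommRing K]

/-- The map `K[[x]]ˢ → K ⊗ M / ⟨x⟩ᵐ M` given by truncation and `π`. -/
def stageMap (m : ℕ) : (Fin s → MvPowerSeries (Fin n) K) →ₗ[K] K ⊗[ℤ] XQuot n M m :=
  ∑ i, ∑ d ∈ lowExponents n m,
    (LinearMap.toSpanSingleton K _ (1 ⊗ₜ stageProj π m (monomialVec ℤ i d))).comp
      ((MvPowerSeries.coeff d).comp (LinearMap.proj i))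

theorem stageMap_apply (m : ℕ) (v : Fin s → MvPowerSeries (Fin n) K) :
    stageMap π K m v = ∑ i, ∑ d ∈ lowExponents n m,
      MvPowerSeries.coeff d (v i) • ((1 : K) ⊗ₜ[ℤ] stageProj π m (monomialVec ℤ i d)) := by
  simp [stageMap, LinearMap.sum_apply]

theorem stageMap_mapVec (m : ℕ) (u : Fin s → MvPowerSeries (Fin n) ℤ) :
    stageMap π K m (mapVec K _ u) = 1 ⊗ₜ stageProj π m u := by
  rw [stageMap_apply, stageProj_eq_sum]
  simp only [TensorProduct.tmul_sum, mapVec_apply, MvPowerSeries.coeff_map, eq_intCast,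
    TensorProduct.tmul_smul, Int.cast_smul_eq_zsmul]

theorem stageMap_eq_zero_of_mem {m : ℕ} {v : Fin s → MvPowerSeries (Fin n) K}
    (hv : v ∈ (varIdeal n K ^ m • ⊤ : Submodule (MvPowerSeries (Fin n) K) _)) :
    stageMap π K m v = 0 := by
  rw [mem_varIdeal_pow_smul_top_iff] at hv
  rw [stageMap_apply]
  refine Finset.sum_eq_zero fun i _ => Finset.sum_eq_zero fun d hd => ?_
  rw [hv i d (mem_lowExponents.1 hd), zero_smul]

variable {π} in
theorem stageMap_surjective (hsurj : Function.Surjective π) (m : ℕ) :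
    Function.Surjective (stageMap π K m) := by
  rw [← LinearMap.range_eq_top, eq_top_iff]
  rintro t -
  induction t with
  | zero => exact Submodule.zero_mem _
  | tmul k a =>
    obtain ⟨u, rfl⟩ := stageProj_surjective hsurj m a
    refine ⟨k • mapVec K _ u, ?_⟩
    rw [map_smul, stageMap_mapVec, TensorProduct.smul_tmul', smul_eq_mul, mul_one]
  | add t u ht hu => exact Submodule.add_mem _ ht hu

theorem xProj_stageMap {m l : ℕ} (h : m ≤ l) :
    ((xProj n M h).baseChange K).comp (stageMap π K l) = stageMap π K m := by
  refine linearMap_ext_of_truncation l (fun v hv => ?_) (fun v hv => ?_) fun u => ?_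
  · rw [LinearMap.comp_apply, stageMap_eq_zero_of_mem π K hv, map_zero]
  · exact stageMap_eq_zero_of_mem π K
      (Submodule.smul_mono_left (Ideal.pow_le_pow_right h) hv)
  · rw [LinearMap.comp_apply, stageMap_mapVec, stageMap_mapVec, LinearMap.baseChange_tmul,
      xProj_stageProj]

/-- The map from `K[[x]]ˢ` to the completed fibre of `M`. -/
def fibreMap : (Fin s → MvPowerSeries (Fin n) K) →ₗ[K] completedFibre n K M :=
  (LinearMap.pi (stageMap π K)).codRestrict _ fun v _ _ h =>
    LinearMap.congr_fun (xProj_stageMap π K h) v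

@[simp]
theorem fibreMap_apply (v : Fin s → MvPowerSeries (Fin n) K) (m : ℕ) :
    (fibreMap π K v : ∀ m, K ⊗[ℤ] XQuot n M m) m = stageMap π K m v := rfl

end Stage

/-! ### The completed fibre as a cokernel -/

section Coker

variable {n r s : ℕ} {M : Type*} [AddCommGroup M] [Module (MvPowerSeries (Fin n) ℤ) M]
  {T : Matrix (Fin s) (Fin r) (MvPowerSeries (Fin n) ℤ)}
  {π : (Fin s → MvPowerSeries (Fin n) ℤ) →ₗ[MvPowerSeries (Fin n) ℤ] M}
  (K : Type*) [CommRing K]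

theorem stageMap_mulVecLin (hexact : Function.Exact T.mulVecLin π) (m : ℕ)
    (w : Fin r → MvPowerSeries (Fin n) K) :
    stageMap π K m ((inducedMatrix K T).mulVecLin w) = 0 := by
  have h : (stageMap π K m).comp ((inducedMatrix K T).mulVecLin.restrictScalars K) = 0 := by
    refine linearMap_ext_of_truncation m (fun v hv => ?_) (fun v _ => rfl) fun u => ?_
    · refine stageMap_eq_zero_of_mem π K ?_
      have h := Submodule.mem_map_of_mem (f := (inducedMatrix K T).mulVecLin) hv
      rw [Submodule.map_smul''] at h
      exact Submodule.smul_mono le_rfl le_top h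
    · rw [LinearMap.comp_apply, LinearMap.restrictScalars_apply, inducedMatrix_mulVec_mapVec,
        stageMap_mapVec, stageProj_apply, hexact.apply_apply_eq_zero]
      simp
  exact LinearMap.congr_fun h w

theorem stageProj_eq_zero (hexact : Function.Exact T.mulVecLin π)
    (hsurj : Function.Surjective π) {m : ℕ}
    {u : Fin s → MvPowerSeries (Fin n) ℤ} (hu : stageProj π m u = 0) :
    u ∈ LinearMap.range T.mulVecLin ⊔
      (varIdeal n ℤ ^ m • ⊤ : Submodule (MvPowerSeries (Fin n) ℤ) _) := by
  rw [stageProj_apply, Submodule.Quotient.mk_eq_zero, ← LinearMap.range_eq_top.2 hsurj,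
    LinearMap.range_eq_map, ← Submodule.map_smul''] at hu
  obtain ⟨h, hh, hhu⟩ := hu
  have h1 : u - h ∈ LinearMap.range T.mulVecLin := by
    rw [← hexact.linearMap_ker_eq, LinearMap.mem_ker, map_sub, hhu, sub_self]
  rw [← sub_add_cancel u h]
  exact Submodule.add_mem_sup h1 hh

/-- The quotient map `q` by the right-hand side factors through `stageMap`: on integral vectors it
kills the kernel of `stageProj`, so it descends to `M/⟨x⟩ᵐM` and extends `K`-linearly to the tensor
product. -/
theorem mem_of_stageMap_eq_zero (hexact : Function.Exact T.mulVecLin π)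
    (hsurj : Function.Surjective π) {m : ℕ}
    {v : Fin s → MvPowerSeries (Fin n) K} (hv : stageMap π K m v = 0) :
    v ∈ LinearMap.range (inducedMatrix K T).mulVecLin ⊔
      (varIdeal n K ^ m • ⊤ : Submodule (MvPowerSeries (Fin n) K) _) := by
  set L := LinearMap.range (inducedMatrix K T).mulVecLin ⊔
      (varIdeal n K ^ m • ⊤ : Submodule (MvPowerSeries (Fin n) K) _) with hL
  let q : (Fin s → MvPowerSeries (Fin n) K) →ₗ[K] _ ⧸ L := L.mkQ.restrictScalars K
  have hq : ∀ v, q v = 0 ↔ v ∈ L := fun v => Submodule.Quotient.mk_eq_zero L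
  let g : (Fin s → MvPowerSeries (Fin n) ℤ) →ₗ[ℤ] _ ⧸ L :=
    (q.toAddMonoidHom.comp (mapVec K _).toAddMonoidHom).toIntLinearMap
  have hg : ∀ u, g u = q (mapVec K _ u) := fun _ => rfl
  have hker : LinearMap.ker (stageProj π m) ≤ LinearMap.ker g := by
    intro u hu
    rw [LinearMap.mem_ker, hg, hq]
    obtain ⟨a, ⟨w, rfl⟩, b, hb, rfl⟩ :=
      Submodule.mem_sup.1 (stageProj_eq_zero hexact hsurj (LinearMap.mem_ker.1 hu))
    rw [map_add, ← inducedMatrix_mulVec_mapVec]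
    exact Submodule.add_mem_sup ⟨_, rfl⟩ (mapVec_mem hb)
  let g' : XQuot n M m →ₗ[ℤ] _ ⧸ L := ((LinearMap.ker (stageProj π m)).liftQ g hker).comp
    ((stageProj π m).quotKerEquivOfSurjective (stageProj_surjective hsurj m)).symm.toLinearMap
  have hg' : ∀ u, g' (stageProj π m u) = q (mapVec K _ u) := by
    intro u
    have : ((stageProj π m).quotKerEquivOfSurjective (stageProj_surjective hsurj m)).symm
        (stageProj π m u) = Submodule.Quotient.mk u := by
      rw [LinearEquiv.symm_apply_eq]; rfl
    simp only [g', LinearMap.comp_apply, LinearEquiv.coe_coe, this]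
    rfl
  have hcomp : (g'.liftBaseChange K).comp (stageMap π K m) = q := by
    refine linearMap_ext_of_truncation m (fun v hv => ?_) (fun v hv => ?_) fun u => ?_
    · rw [LinearMap.comp_apply, stageMap_eq_zero_of_mem π K hv, map_zero]
    · exact (hq v).2 (Submodule.mem_sup_right hv)
    · rw [LinearMap.comp_apply, stageMap_mapVec, LinearMap.liftBaseChange_tmul, one_smul, hg']
  rw [← hq, ← hcomp, LinearMap.comp_apply, hv, map_zero]

theorem stageMap_eq_zero_iff (hexact : Function.Exact T.mulVecLin π)
    (hsurj : Function.Surjective π) {m : ℕ} {v : Fin s → MvPowerSeries (Fin n) K} :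
    stageMap π K m v = 0 ↔
      (Submodule.Quotient.mk v : inducedCoker K T) ∈
        (varIdeal n K ^ m • ⊤ : Submodule (MvPowerSeries (Fin n) K) (inducedCoker K T)) := by
  have hmap : (varIdeal n K ^ m • ⊤ : Submodule (MvPowerSeries (Fin n) K) (inducedCoker K T)) =
      (varIdeal n K ^ m • ⊤ : Submodule (MvPowerSeries (Fin n) K) _).map (Submodule.mkQ _) := by
    rw [Submodule.map_smul'', Submodule.map_top, Submodule.range_mkQ]
  rw [hmap]
  constructor
  · intro hv
    obtain ⟨a, ha, b, hb, rfl⟩ := Submodule.mem_sup.1 (mem_of_stageMap_eq_zero K hexact hsurj hv)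
    refine ⟨b, hb, ?_⟩
    rw [Submodule.mkQ_apply, eq_comm, Submodule.Quotient.eq]
    simpa using ha
  · rintro ⟨b, hb, hbv⟩
    rw [Submodule.mkQ_apply, eq_comm, Submodule.Quotient.eq] at hbv
    obtain ⟨w, hw⟩ := hbv
    rw [← sub_add_cancel v b, map_add, ← hw, stageMap_mulVecLin K hexact,
      stageMap_eq_zero_of_mem π K hb, add_zero]

/-- Evaluation of the completed fibre at stage `m`. -/
def evalStage (n : ℕ) (M : Type*) [AddCommGroup M] [Module (MvPowerSeries (Fin n) ℤ) M]
    (K : Type*) [CommRing K] (m : ℕ) : completedFibre n K M →ₗ[K] K ⊗[ℤ] XQuot n M m :=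
  (LinearMap.proj m).comp (completedFibre n K M).subtype

theorem evalStage_surjective (hsurj : Function.Surjective π) (m : ℕ) :
    Function.Surjective (evalStage n M K m) := fun t =>
  let ⟨v, hv⟩ := stageMap_surjective K hsurj m t
  ⟨fibreMap π K v, hv⟩

variable [IsNoetherianRing K]

/-- Vanishing at every stage puts the class of `v` in all `⟨x⟩ᵐ • inducedCoker K T`, whose
intersection is zero. -/
theorem fibreMap_eq_zero_iff (hexact : Function.Exact T.mulVecLin π)
    (hsurj : Function.Surjective π) {v : Fin s → MvPowerSeries (Fin n) K} :
    fibreMap π K v = 0 ↔ v ∈ LinearMap.range (inducedMatrix K T).mulVecLin := by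
  have := isAdicComplete_of_finite (varIdeal n K) (inducedCoker K T)
  constructor
  · intro hv
    rw [← Submodule.Quotient.mk_eq_zero]
    refine IsHausdorff.haus this.toIsHausdorff _ fun m => ?_
    rw [SModEq.zero, ← stageMap_eq_zero_iff K hexact hsurj, ← fibreMap_apply, hv]
    rfl
  · rintro ⟨w, rfl⟩
    ext m
    exact stageMap_mulVecLin K hexact m w

theorem fibreMap_surjective (hexact : Function.Exact T.mulVecLin π)
    (hsurj : Function.Surjective π) : Function.Surjective (fibreMap π K) := by
  have := isAdicComplete_of_finite (varIdeal n K) (inducedCoker K T)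
  rintro ⟨f, hf⟩
  choose v hv using fun m => stageMap_surjective K hsurj m (f m)
  -- The stagewise lifts `v m` need not converge in `K[[x]]ˢ`; only their classes in the cokernel
  -- form a Cauchy sequence.
  obtain ⟨c, hc⟩ := this.toIsPrecomplete.prec
    (f := fun m => (Submodule.Quotient.mk (v m) : inducedCoker K T)) (by
      intro m l h
      rw [SModEq.sub_mem, ← Submodule.Quotient.mk_sub, ← stageMap_eq_zero_iff K hexact hsurj,
        map_sub, hv, sub_eq_zero, ← xProj_stageMap π K h, LinearMap.comp_apply, hv]
      exact (hf m l h).symm)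
  obtain ⟨v', rfl⟩ := Submodule.Quotient.mk_surjective _ c
  refine ⟨v', Subtype.ext (funext fun m => ?_)⟩
  have h := hc m
  rw [SModEq.sub_mem, ← Submodule.Quotient.mk_sub, ← stageMap_eq_zero_iff K hexact hsurj,
    map_sub, hv, sub_eq_zero] at h
  exact h.symm

theorem nonempty_completedFibre_equiv (hexact : Function.Exact T.mulVecLin π)
    (hsurj : Function.Surjective π) :
    Nonempty (completedFibre n K M ≃ₗ[K] inducedCoker K T) := by
  let q : (Fin s → MvPowerSeries (Fin n) K) →ₗ[K] inducedCoker K T :=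
    (Submodule.mkQ _).restrictScalars K
  have hq : Function.Surjective q := fun c => by
    obtain ⟨v, rfl⟩ := Submodule.Quotient.mk_surjective _ c
    exact ⟨v, rfl⟩
  refine nonempty_linearEquiv_of_surjective (fibreMap_surjective K hexact hsurj) hq fun v => ?_
  rw [fibreMap_eq_zero_iff K hexact hsurj]
  exact (Submodule.Quotient.mk_eq_zero _).symm

end Coker
end FormalFamily
end

noncomputable section
namespace FormalFamily

/-! ### Base change to fields and torsion -/

section BaseChange

variable {R : Type*} [CommRing R] {A B : Type*} [AddCommGroup A] [AddCommGroup B]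
  [Module R A] [Module R B]

/-- By right exactness the kernel is the image of `K ⊗ ker f`, and there `c ⊗ b = e⁻¹c ⊗ eb = 0`. -/
theorem baseChange_injective_of_smul_ker_eq_zero (K : Type*) [Field K] [Algebra R K]
    {f : A →ₗ[R] B} (hf : Function.Surjective f) {e : R}
    (he : algebraMap R K e ≠ 0) (h : ∀ a, f a = 0 → e • a = 0) :
    Function.Injective (f.baseChange K) := by
  rw [injective_iff_map_eq_zero]
  intro t ht
  obtain ⟨y, rfl⟩ := (lTensor_exact K (LinearMap.exact_subtype_ker_map f) hf t).1 ht
  clear ht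
  induction y with
  | zero => exact map_zero _
  | tmul c b =>
    have hc : c = e • ((algebraMap R K e)⁻¹ * c) := by
      rw [Algebra.smul_def, mul_inv_cancel_left₀ he]
    rw [LinearMap.lTensor_tmul, Submodule.subtype_apply, hc, TensorProduct.smul_tmul, h _ b.2,
      TensorProduct.tmul_zero]
  | add y z hy hz => rw [map_add, hy, hz, add_zero]

theorem baseChange_surjective (K : Type*) [CommRing K] [Algebra R K] {f : A →ₗ[R] B}
    (hf : Function.Surjective f) : Function.Surjective (f.baseChange K) :=
  LinearMap.lTensor_surjective K hf

variable [IsDomain R]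

theorem exists_smul_eq_zero_of_isTorsion [Module.Finite R A] (h : Module.IsTorsion R A) :
    ∃ e : R, e ≠ 0 ∧ ∀ a : A, e • a = 0 := by
  obtain ⟨e, he, he0⟩ := Submodule.annihilator_top_inter_nonZeroDivisors h
  exact ⟨e, nonZeroDivisors.ne_zero he0, fun a => Submodule.mem_annihilator.1 he a trivial⟩

/-- Each `b` in the kernel has `1 ⊗ b = 0` in the localization `F ⊗ A`, so it is torsion. Since `R`
is noetherian the kernel is finite, and one `e` serves all of it. -/
theorem exists_smul_ker_eq_zero_of_baseChange_injective (F : Type*) [Field F] [Algebra R F]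
    [IsFractionRing R F] [IsNoetherianRing R] [Module.Finite R A] {f : A →ₗ[R] B}
    (h : Function.Injective (f.baseChange F)) :
    ∃ e : R, e ≠ 0 ∧ ∀ a : A, f a = 0 → e • a = 0 := by
  have htors : Module.IsTorsion R (LinearMap.ker f) := by
    rintro ⟨b, hb⟩
    have h0 : TensorProduct.mk R F A 1 b = 0 := by
      apply h
      rw [TensorProduct.mk_apply, LinearMap.baseChange_tmul, LinearMap.mem_ker.1 hb,
        TensorProduct.tmul_zero, map_zero]
    obtain ⟨s, hs⟩ := (IsLocalizedModule.eq_zero_iff (nonZeroDivisors R) _).1 h0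
    exact ⟨s, Subtype.ext hs⟩
  obtain ⟨e, he, hker⟩ := exists_smul_eq_zero_of_isTorsion htors
  exact ⟨e, he, fun a ha => congrArg Subtype.val (hker ⟨a, ha⟩)⟩

/-- The fibre dimensions of a finitely generated module over a principal ideal domain are at
least its rank, with equality away from the zero locus of some nonzero element. -/
theorem exists_rank_baseChange (R : Type) [CommRing R] [IsDomain R] [IsPrincipalIdealRing R]
    (A : Type*) [AddCommGroup A] [Module R A] [Module.Finite R A] :
    ∃ (k : ℕ) (e : R), e ≠ 0 ∧ ∀ (K : Type) [Field K] [Algebra R K],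
      (k : Cardinal) ≤ Module.rank K (K ⊗[R] A) ∧
        (algebraMap R K e ≠ 0 → Module.rank K (K ⊗[R] A) = k) := by
  obtain ⟨e, he, h⟩ := exists_smul_eq_zero_of_isTorsion (A := Submodule.torsion R A)
    Submodule.torsion_isTorsion
  refine ⟨Module.finrank R (A ⧸ Submodule.torsion R A), e, he, fun K _ _ => ?_⟩
  have hsurj := Submodule.mkQ_surjective (Submodule.torsion R A)
  -- A finite torsion-free module over a principal ideal domain is free, so base change preserves
  -- its rank.
  have hrank : Module.rank K (K ⊗[R] (A ⧸ Submodule.torsion R A)) =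
      (Module.finrank R (A ⧸ Submodule.torsion R A) : Cardinal) := by
    rw [Module.rank_baseChange, ← Module.finrank_eq_rank, Cardinal.lift_natCast]
  rw [← hrank]
  refine ⟨LinearMap.rank_le_of_surjective _ (baseChange_surjective K hsurj), fun he => ?_⟩
  refine (LinearEquiv.ofBijective ((Submodule.mkQ (Submodule.torsion R A)).baseChange K)
    ⟨baseChange_injective_of_smul_ker_eq_zero K hsurj he fun a ha => ?_,
      baseChange_surjective K hsurj⟩).rank_eq
  rw [Submodule.mkQ_apply, Submodule.Quotient.mk_eq_zero] at ha
  exact congrArg Subtype.val (h ⟨a, ha⟩)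

end BaseChange

/-! ### Stabilization of the inverse system -/

section Transition

variable {n : ℕ} {M : Type*} [AddCommGroup M] [Module (MvPowerSeries (Fin n) ℤ) M]

theorem xProj_surjective {m l : ℕ} (h : m ≤ l) : Function.Surjective (xProj n M h) := fun a => by
  obtain ⟨x, rfl⟩ := Submodule.Quotient.mk_surjective _ a
  exact ⟨Submodule.Quotient.mk x, rfl⟩

theorem evalStage_injective (K : Type*) [CommRing K] {N : ℕ}
    (hN : ∀ m ≥ N, Function.Injective ((xProj n M (Nat.le_succ m)).baseChange K)) :
    Function.Injective (evalStage n M K N) := by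
  rintro ⟨f, hf⟩ ⟨g, hg⟩ hfg
  have hfg : f N = g N := hfg
  refine Subtype.ext (funext fun m => ?_)
  rcases le_total m N with h | h
  · change f m = g m
    rw [← hf m N h, ← hg m N h, hfg]
  · change f m = g m
    induction m, h using Nat.le_induction with
    | base => exact hfg
    | succ m hm ih =>
      apply hN m hm
      rw [hf m _ m.le_succ, hg m _ m.le_succ, ih]

theorem rank_completedFibre_eq {s : ℕ}
    {π : (Fin s → MvPowerSeries (Fin n) ℤ) →ₗ[MvPowerSeries (Fin n) ℤ] M}
    (hsurj : Function.Surjective π) (K : Type*) [CommRing K] {N : ℕ}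
    (hN : ∀ m ≥ N, Function.Injective ((xProj n M (Nat.le_succ m)).baseChange K)) :
    Module.rank K (completedFibre n K M) = Module.rank K (K ⊗[ℤ] XQuot n M N) :=
  (LinearEquiv.ofBijective (evalStage n M K N)
    ⟨evalStage_injective K hN, evalStage_surjective K hsurj N⟩).rank_eq

/-- If all stages of the fibre have bounded dimension, the transition maps are eventually
injective. -/
theorem exists_injective_transition (K : Type*) [Field K] {d : ℕ}
    (h : ∀ m, Module.rank K (K ⊗[ℤ] XQuot n M m) ≤ d) :
    ∃ N : ℕ, ∀ m ≥ N, Function.Injective ((xProj n M (Nat.le_succ m)).baseChange K) := by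
  have hfin : ∀ m, Module.Finite K (K ⊗[ℤ] XQuot n M m) := fun m =>
    Module.rank_lt_aleph0_iff.1 ((h m).trans_lt (Cardinal.natCast_lt_aleph0))
  let a : ℕ → ℕ := fun m => Module.finrank K (K ⊗[ℤ] XQuot n M m)
  have ha : Monotone a := monotone_nat_of_le_succ fun m =>
    LinearMap.finrank_le_finrank_of_surjective
      (f := (xProj n M m.le_succ).baseChange K) (baseChange_surjective K (xProj_surjective _))
  have hbdd : BddAbove (Set.range a) := by
    refine ⟨d, ?_⟩
    rintro _ ⟨m, rfl⟩
    exact Module.finrank_le_of_rank_le (h m)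
  -- A bounded set of naturals contains its supremum, so the monotone dimensions are constant from
  -- `N` on.
  obtain ⟨N, hN⟩ := Nat.sSup_mem (Set.range_nonempty a) hbdd
  have hconst : ∀ m ≥ N, a m = a N := fun m hm =>
    le_antisymm (hN ▸ le_csSup hbdd ⟨m, rfl⟩) (ha hm)
  refine ⟨N, fun m hm => ?_⟩
  refine (LinearMap.injective_iff_surjective_of_finrank_eq_finrank ?_).2
    (baseChange_surjective K (xProj_surjective _))
  exact (hconst _ (hm.trans m.le_succ)).trans (hconst m hm).symm

/-- If a transition map becomes injective over `ℚ`, its kernel is killed by a nonzero integer. -/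
theorem exists_smul_mem_of_injective {N : ℕ} [Module.Finite ℤ (XQuot n M (N + 1))]
    (h : Function.Injective ((xProj n M N.le_succ).baseChange ℚ)) :
    ∃ e : ℤ, e ≠ 0 ∧ ∀ x ∈ (xIdeal n ^ N • ⊤ : Submodule (MvPowerSeries (Fin n) ℤ) M),
      e • x ∈ (xIdeal n ^ (N + 1) • ⊤ : Submodule (MvPowerSeries (Fin n) ℤ) M) := by
  obtain ⟨e, he, hker⟩ := exists_smul_ker_eq_zero_of_baseChange_injective ℚ h
  refine ⟨e, he, fun x hx => ?_⟩
  rw [← Submodule.Quotient.mk_eq_zero]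
  have hx0 : xProj n M N.le_succ (Submodule.Quotient.mk x) = 0 :=
    (Submodule.Quotient.mk_eq_zero _).2 hx
  exact hker _ hx0

theorem zsmul_mem_ideal_smul {A N : Type*} [CommRing A] [AddCommGroup N] [Module A N] (I : Ideal A)
    {P Q : Submodule A N} {e : ℤ} (h : ∀ x ∈ P, e • x ∈ Q) : ∀ x ∈ I • P, e • x ∈ I • Q := by
  intro x hx
  refine Submodule.smul_induction_on hx (fun a ha y hy => ?_) fun y z hy hz => ?_
  · rw [smul_comm e a y]
    exact Submodule.smul_mem_smul ha (h y hy)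
  · rw [smul_add]
    exact Submodule.add_mem _ hy hz

/-- Multiply the hypothesis by `⟨x⟩ᵏ` with `m = k + N`. That `e` does not depend on `m` is what
keeps the set of excluded primes finite. -/
theorem smul_mem_pow_of_smul_mem {N m : ℕ} (hm : N ≤ m) {e : ℤ}
    (h : ∀ x ∈ (xIdeal n ^ N • ⊤ : Submodule (MvPowerSeries (Fin n) ℤ) M),
      e • x ∈ (xIdeal n ^ (N + 1) • ⊤ : Submodule (MvPowerSeries (Fin n) ℤ) M)) :
    ∀ x ∈ (xIdeal n ^ m • ⊤ : Submodule (MvPowerSeries (Fin n) ℤ) M),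
      e • x ∈ (xIdeal n ^ (m + 1) • ⊤ : Submodule (MvPowerSeries (Fin n) ℤ) M) := by
  obtain ⟨k, rfl⟩ := Nat.exists_eq_add_of_le' hm
  rw [add_assoc, pow_add, pow_add _ k (N + 1), Submodule.mul_smul, Submodule.mul_smul]
  exact zsmul_mem_ideal_smul _ h

theorem injective_transition_of_smul_mem (K : Type*) [Field K] {N : ℕ} {e : ℤ} (he : (e : K) ≠ 0)
    (h : ∀ x ∈ (xIdeal n ^ N • ⊤ : Submodule (MvPowerSeries (Fin n) ℤ) M),
      e • x ∈ (xIdeal n ^ (N + 1) • ⊤ : Submodule (MvPowerSeries (Fin n) ℤ) M)) :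
    ∀ m ≥ N, Function.Injective ((xProj n M (Nat.le_succ m)).baseChange K) := by
  intro m hm
  refine baseChange_injective_of_smul_ker_eq_zero K (xProj_surjective _) he fun a ha => ?_
  obtain ⟨x, rfl⟩ := Submodule.Quotient.mk_surjective _ a
  have hx : x ∈ (xIdeal n ^ m • ⊤ : Submodule (MvPowerSeries (Fin n) ℤ) M) :=
    (Submodule.Quotient.mk_eq_zero _).1 ha
  exact (Submodule.Quotient.mk_eq_zero _).2 (smul_mem_pow_of_smul_mem hm h x hx)

end Transition

/-! ### Comparison of fibre dimensions -/

section Semicontinuity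

variable {n s : ℕ} {M : Type*} [AddCommGroup M] [Module (MvPowerSeries (Fin n) ℤ) M]
  {π : (Fin s → MvPowerSeries (Fin n) ℤ) →ₗ[MvPowerSeries (Fin n) ℤ] M}

theorem rank_stage_le (hsurj : Function.Surjective π) (K : Type*) [CommRing K] (m : ℕ) :
    Module.rank K (K ⊗[ℤ] XQuot n M m) ≤ Module.rank K (completedFibre n K M) :=
  LinearMap.rank_le_of_surjective _ (evalStage_surjective K hsurj m)

theorem rank_rat_le_rank_of_lt_aleph0 (hsurj : Function.Surjective π) (K : Type) [Field K]
    (h : Module.rank K (completedFibre n K M) < Cardinal.aleph0) :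
    Module.rank ℚ (completedFibre n ℚ M) ≤ Module.rank K (completedFibre n K M) := by
  have hle : ∀ m, Module.rank ℚ (ℚ ⊗[ℤ] XQuot n M m) ≤
      Module.rank K (completedFibre n K M) := fun m => by
    have := finite_xQuot hsurj m
    obtain ⟨k, e, he, hk⟩ := exists_rank_baseChange ℤ (XQuot n M m)
    -- No nonzero integer vanishes in `ℚ`, so the rational stage attains the minimal dimension `k`.
    rw [(hk ℚ).2 (Int.cast_ne_zero.2 he)]
    exact (hk K).1.trans (rank_stage_le hsurj K m)
  obtain ⟨d, hd⟩ := Cardinal.lt_aleph0.1 h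
  obtain ⟨N, hN⟩ := exists_injective_transition ℚ (d := d) fun m => (hle m).trans hd.le
  rw [rank_completedFibre_eq hsurj ℚ hN]
  exact hle N

theorem finite_setOf_rank_ne_rank_rat (hsurj : Function.Surjective π)
    (h : Module.rank ℚ (completedFibre n ℚ M) < Cardinal.aleph0) :
    {q : ℕ | q.Prime ∧ ¬ Module.rank (ZMod q) (completedFibre n (ZMod q) M) =
      Module.rank ℚ (completedFibre n ℚ M)}.Finite := by
  obtain ⟨d, hd⟩ := Cardinal.lt_aleph0.1 h
  obtain ⟨N, hN⟩ := exists_injective_transition ℚ (d := d) fun m =>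
    (rank_stage_le hsurj ℚ m).trans hd.le
  have := finite_xQuot hsurj N
  have := finite_xQuot hsurj (N + 1)
  obtain ⟨e, he, hmem⟩ := exists_smul_mem_of_injective (hN N le_rfl)
  obtain ⟨k, e', he', hk⟩ := exists_rank_baseChange ℤ (XQuot n M N)
  -- The exceptional primes divide `e * e'`: `e` controls all transitions beyond `N`, and `e'` the
  -- dimension of stage `N` itself.
  refine (Nat.divisors (e * e').natAbs).finite_toSet.subset ?_
  rintro q ⟨hq, hne⟩
  have : Fact q.Prime := ⟨hq⟩
  by_contra hdvd
  have hcast : ((e * e' : ℤ) : ZMod q) ≠ 0 := by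
    rw [Ne, ZMod.intCast_zmod_eq_zero_iff_dvd]
    intro h
    exact hdvd (Finset.mem_coe.2 (Nat.mem_divisors.2
      ⟨Int.natCast_dvd.1 h, Int.natAbs_ne_zero.2 (mul_ne_zero he he')⟩))
  rw [Int.cast_mul] at hcast
  apply hne
  rw [rank_completedFibre_eq hsurj ℚ hN, rank_completedFibre_eq hsurj (ZMod q)
    (injective_transition_of_smul_mem (ZMod q) (left_ne_zero_of_mul hcast) hmem),
    (hk ℚ).2 (Int.cast_ne_zero.2 he'), (hk (ZMod q)).2 (right_ne_zero_of_mul hcast)]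

end Semicontinuity
end FormalFamily
end

theorem corollary1p13 {n r s : ℕ} {M : Type*} [AddCommGroup M]
    [Module (MvPowerSeries (Fin n) ℤ) M]
    (T : Matrix (Fin s) (Fin r) (MvPowerSeries (Fin n) ℤ))
    (π : (Fin s → MvPowerSeries (Fin n) ℤ) →ₗ[MvPowerSeries (Fin n) ℤ] M)
    (hexact : Function.Exact T.mulVecLin π) (hsurj : Function.Surjective π) :
    -- the completed fibres are the cokernels of the induced matrices
    (∀ p : ℕ, p.Prime → Nonempty
      (FormalFamily.completedFibre n (ZMod p) M ≃ₗ[ZMod p]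
        FormalFamily.inducedCoker (ZMod p) T)) ∧
    Nonempty (FormalFamily.completedFibre n ℚ M ≃ₗ[ℚ] FormalFamily.inducedCoker ℚ T) ∧
    -- part 1
    (∀ p : ℕ, p.Prime →
      Module.rank (ZMod p) (FormalFamily.completedFibre n (ZMod p) M) < Cardinal.aleph0 →
      Module.rank ℚ (FormalFamily.completedFibre n ℚ M) ≤
          Module.rank (ZMod p) (FormalFamily.completedFibre n (ZMod p) M) ∧
        {q : ℕ | q.Prime ∧
          ¬ Module.rank (ZMod q) (FormalFamily.completedFibre n (ZMod q) M) ≤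
            Module.rank (ZMod p) (FormalFamily.completedFibre n (ZMod p) M)}.Finite) ∧
    -- part 2
    (Module.rank ℚ (FormalFamily.completedFibre n ℚ M) < Cardinal.aleph0 →
      {q : ℕ | q.Prime ∧
        ¬ Module.rank (ZMod q) (FormalFamily.completedFibre n (ZMod q) M) =
          Module.rank ℚ (FormalFamily.completedFibre n ℚ M)}.Finite) := by
  refine ⟨fun p hp => ?_, FormalFamily.nonempty_completedFibre_equiv ℚ hexact hsurj,
    fun p hp h => ?_, FormalFamily.finite_setOf_rank_ne_rank_rat hsurj⟩
  · have : Fact p.Prime := ⟨hp⟩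
    exact FormalFamily.nonempty_completedFibre_equiv (ZMod p) hexact hsurj
  · have : Fact p.Prime := ⟨hp⟩
    have hle := FormalFamily.rank_rat_le_rank_of_lt_aleph0 hsurj (ZMod p) h
    -- Now `M_0` is finite-dimensional, so part 2 gives `dim M_q = dim M_0 ≤ dim M_p` for almost all
    -- `q`.
    refine ⟨hle, (FormalFamily.finite_setOf_rank_ne_rank_rat hsurj (hle.trans_lt h)).subset ?_⟩
    rintro q ⟨hq, hne⟩
    exact ⟨hq, fun heq => hne (heq.trans_le hle)⟩
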